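/- Let $n\ge 0$. A contact structure on a smooth $(2n+1)$-dimensional manifold $M$ is a field $\xi\subset TM$ of hyperplanes that can be written locally as $\xi=\ker\alpha$ for a smooth $1$-form $\alpha$ with $\alpha\wedge(d\alpha)^n\neq 0$ everywhere. Let $\mathbb R^{2n+1}_{st}$ be $\mathbb R^{2n+1}$, with coordinates $(x_1,\dots,x_n,y_1,\dots,y_n,z)$, endowed with the contact structure $\xi_{st}=\ker\bigl(dz+\sum_{i=1}^n x_i\,dy_i\bigr)$. Open subsets of contact manifolds are contactomorphic if there is a diffeomorphism between them whose differential maps the one contact structure onto the other. A contact ball in $(M,\xi)$ is the image $\phi(U)$ of a smooth chart $\phi\colon U\to M$ (a diffeomorphism from an open set $U\subset\mathbb R^{2n+1}$ onto an open subset of $M$) such that $\phi^*\xi=\xi_{st}|_U$ and $(U,\xi_{st})$ is contactomorphic to $\mathbb R^{2n+1}_{st}$. Let $C(M,\xi)$ be the minimal number $k$ such that $M$ is the union of $k$ contact balls. Proposition. Let $\xi$ be a contact structure on the sphere $S^{2n+1}$ (with its standard smooth structure) such that $C(S^{2n+1},\xi)=2$. Then for every point $p\in S^{2n+1}$ the complement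 $(S^{2n+1}\setminus\{p\},\xi)$ is contactomorphic to an open subset of $\mathbb R^{2n+1}_{st}$. -/

import Mathlib

open scoped Manifold ContDiff

noncomputable section

/-- The model space `ℝ^{2n+1}`. Its coordinates are ordered as `(x_1, …, x_n, y_1, …, y_n, z)`. -/
abbrev ContactModel (n : ℕ) : Type := EuclideanSpace ℝ (Fin (2 * n + 1))

/-! ### Contact forms on open subsets of `ℝ^{2n+1}` -/

/-- The exterior derivative `dα` of a 1-form `α` on `ℝ^{2n+1}`, at the point `u`,
evaluated on the pair of vectors `(v, w)`. -/
def dOneForm (n : ℕ) (α : ContactModel n → (ContactModel n →L[ℝ] ℝ)) (u v w : ContactModel n) :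
    ℝ :=
  extDeriv (fun x => ContinuousAlternatingMap.ofSubsingleton ℝ (ContactModel n) ℝ (0 : Fin 1) (α x))
    u ![v, w]

/-- The `(2n+1)`-form `α ∧ (dα)^n` at the point `u`, evaluated on `v_0, …, v_{2n}`:
`(1 / 2^n) ∑_σ sgn(σ) α(v_{σ(0)}) ∏_{i < n} dα(v_{σ(2i+1)}, v_{σ(2i+2)})`,
the sum running over all permutations `σ` of `{0, …, 2n}`. -/
def wedgeTop (n : ℕ) (α : ContactModel n → (ContactModel n →L[ℝ] ℝ)) (u : ContactModel n)
    (v : Fin (2 * n + 1) → ContactModel n) : ℝ :=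
  (1 / 2 ^ n : ℝ) * ∑ σ : Equiv.Perm (Fin (2 * n + 1)),
    ((Equiv.Perm.sign σ : ℤ) : ℝ) * α u (v (σ 0)) *
      ∏ i : Fin n, dOneForm n α u
        (v (σ ⟨2 * i.val + 1, by omega⟩)) (v (σ ⟨2 * i.val + 2, by omega⟩))

/-- `α` is a contact form on the set `V` (used for open `V`): it is smooth on `V`, and
`α ∧ (dα)^n` is non-zero at every point of `V`. -/
def IsContactFormOn (n : ℕ) (α : ContactModel n → (ContactModel n →L[ℝ] ℝ))
    (V : Set (ContactModel n)) : Prop :=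
  ContDiffOn ℝ ∞ α V ∧ ∀ u ∈ V, ∃ v : Fin (2 * n + 1) → ContactModel n, wedgeTop n α u v ≠ 0

/-! ### Contact structures on manifolds -/

/-- A field of linear subspaces of the tangent spaces of a `(2n+1)`-dimensional manifold. -/
abbrev PlaneField (n : ℕ) (M : Type*) [TopologicalSpace M] [ChartedSpace (ContactModel n) M] :
    Type _ :=
  ∀ x : M, Submodule ℝ (TangentSpace (𝓡 (2 * n + 1)) x)

/-- The partial homeomorphism `φ` between manifolds is a smooth diffeomorphism from the open set
`φ.source` onto the open set `φ.target`. -/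
def IsDiffeoOnSource (n : ℕ) {M N : Type*}
    [TopologicalSpace M] [ChartedSpace (ContactModel n) M]
    [TopologicalSpace N] [ChartedSpace (ContactModel n) N]
    (φ : OpenPartialHomeomorph M N) : Prop :=
  ContMDiffOn (𝓡 (2 * n + 1)) (𝓡 (2 * n + 1)) ∞ φ φ.source ∧
    ContMDiffOn (𝓡 (2 * n + 1)) (𝓡 (2 * n + 1)) ∞ φ.symm φ.target

/-- The pullback `(φ^* ξ)(x) = {v ∈ T_x M | dφ(x) v ∈ ξ(φ(x))}` of a field of subspaces `ξ`
along a smooth map `φ`. -/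
def pullbackField (n : ℕ) {M N : Type*}
    [TopologicalSpace M] [ChartedSpace (ContactModel n) M]
    [TopologicalSpace N] [ChartedSpace (ContactModel n) N]
    (φ : M → N) (ξ : PlaneField n N) : PlaneField n M :=
  fun x => (ξ (φ x)).comap (mfderiv (𝓡 (2 * n + 1)) (𝓡 (2 * n + 1)) φ x).toLinearMap

/-- `ξ` is a contact structure on the `(2n+1)`-dimensional smooth manifold `M`: around every point
there is a smooth parametrization `φ` by an open subset of `ℝ^{2n+1}` in which `ξ` is the kernel of
a 1-form `α` with `α ∧ (dα)^n ≠ 0`. -/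
def IsContactStructure (n : ℕ) {M : Type*} [TopologicalSpace M] [ChartedSpace (ContactModel n) M]
    [IsManifold (𝓡 (2 * n + 1)) ∞ M] (ξ : PlaneField n M) : Prop :=
  ∀ p : M, ∃ φ : OpenPartialHomeomorph (ContactModel n) M,
    IsDiffeoOnSource n φ ∧ p ∈ φ.target ∧
      ∃ α : ContactModel n → (ContactModel n →L[ℝ] ℝ), IsContactFormOn n α φ.source ∧
        ∀ u ∈ φ.source, pullbackField n φ ξ u = LinearMap.ker (α u).toLinearMap

/-- The standard contact form `α_st = dz + ∑_i x_i dy_i` on `ℝ^{2n+1}`. -/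
def stdContactForm (n : ℕ) (u : ContactModel n) : ContactModel n →L[ℝ] ℝ :=
  EuclideanSpace.proj (Fin.last (2 * n)) +
    ∑ i : Fin n, (u ⟨i.val, by omega⟩) •
      (EuclideanSpace.proj (⟨n + i.val, by omega⟩ : Fin (2 * n + 1)) : ContactModel n →L[ℝ] ℝ)

/-- The standard contact structure `ξ_st = ker α_st` on `ℝ^{2n+1}`. -/
def stdContact (n : ℕ) : PlaneField n (ContactModel n) :=
  fun u => LinearMap.ker (stdContactForm n u).toLinearMap

/-! ### Contactomorphisms, contact balls, and the contact covering number -/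

/-- The open subset `U` of `(M, ξ)` is contactomorphic to the open subset `V` of `(N, η)`: there is
a diffeomorphism `φ : U → V` with `dφ(x) (ξ(x)) = η(φ(x))` for all `x ∈ U`. -/
def Contactomorphic (n : ℕ) {M N : Type*}
    [TopologicalSpace M] [ChartedSpace (ContactModel n) M]
    [TopologicalSpace N] [ChartedSpace (ContactModel n) N]
    (ξ : PlaneField n M) (U : Set M) (η : PlaneField n N) (V : Set N) : Prop :=
  ∃ φ : OpenPartialHomeomorph M N, IsDiffeoOnSource n φ ∧ φ.source = U ∧ φ.target = V ∧
    ∀ x ∈ U, (ξ x).map (mfderiv (𝓡 (2 * n + 1)) (𝓡 (2 * n + 1)) φ x).toLinearMap = η (φ x)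

/-- A Darboux chart `φ : U → M` for `(M, ξ)`, with `U = φ.source ⊆ ℝ^{2n+1}` open: a smooth chart
with `φ^* ξ = ξ_st` on `U`. -/
def IsDarbouxChart (n : ℕ) {M : Type*} [TopologicalSpace M] [ChartedSpace (ContactModel n) M]
    (ξ : PlaneField n M) (φ : OpenPartialHomeomorph (ContactModel n) M) : Prop :=
  IsDiffeoOnSource n φ ∧ ∀ u ∈ φ.source, pullbackField n φ ξ u = stdContact n u

/-- A contact chart: a Darboux chart whose domain `(U, ξ_st)` is contactomorphic to
`(ℝ^{2n+1}, ξ_st)`. -/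
def IsContactChart (n : ℕ) {M : Type*} [TopologicalSpace M] [ChartedSpace (ContactModel n) M]
    (ξ : PlaneField n M) (φ : OpenPartialHomeomorph (ContactModel n) M) : Prop :=
  IsDarbouxChart n ξ φ ∧ Contactomorphic n (stdContact n) φ.source (stdContact n) Set.univ

/-- A contact ball in `(M, ξ)`: the image of a contact chart. -/
def IsContactBall (n : ℕ) {M : Type*} [TopologicalSpace M] [ChartedSpace (ContactModel n) M]
    (ξ : PlaneField n M) (B : Set M) : Prop :=
  ∃ φ : OpenPartialHomeomorph (ContactModel n) M, IsContactChart n ξ φ ∧ φ.target = B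

/-- The contact covering number `C(M, ξ)`: the minimal number `k` of contact balls that cover `M`
(`⊤` if there is no finite cover by contact balls). -/
def contactCoveringNumber (n : ℕ) (M : Type*) [TopologicalSpace M]
    [ChartedSpace (ContactModel n) M] (ξ : PlaneField n M) : ℕ∞ :=
  ⨅ (k : ℕ) (_ : ∃ B : Fin k → Set M, (∀ i, IsContactBall n ξ (B i)) ∧ ⋃ i, B i = Set.univ),
    (k : ℕ∞)

/-! ### Odd-dimensional spheres -/

/-- The dimension fact behind Mathlib's smooth structure on the unit sphere in `ℝ^{2n+2}`. -/
instance factFinrankOddSphere (n : ℕ) :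
    Fact (Module.finrank ℝ (EuclideanSpace ℝ (Fin (2 * n + 2))) = (2 * n + 1) + 1) :=
  ⟨by simp⟩

/-- The unit sphere `S^{2n+1} ⊆ ℝ^{2n+2}`, with Mathlib's smooth structure. -/
abbrev OddSphere (n : ℕ) : Type := Metric.sphere (0 : EuclideanSpace ℝ (Fin (2 * n + 2))) 1

end

/-! Cover the sphere by two contact balls `B ∋ p` and `B'`. The complement of `B'` is a compact
subset of `B`, and `B` is contactomorphic to all of `ℝ^{2n+1}`. It therefore suffices to push the
punctured space `ℝ^{2n+1} ∖ {p}` off a given compact set by a contact embedding that is the identity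
outside a compact set (`Expandable`). Extended by the identity, it embeds `S^{2n+1} ∖ {p}` into
`B'`, and the inverse of a Darboux chart carries `B'` into `ℝ^{2n+1}`.

For the push, let `δ` be a contact dilation by some `t < 1` and `g` a cut-off of `δ`, equal to `δ`
on a large ball and to the identity far away. The infinite product of the conjugates `δ^k g⁻¹
δ^{-k}` is locally finite away from the origin and expels every point other than the origin from the
ball (`expandable_jetForm_zero`). Cutting off is the analytic step: `δ` has a generating function,
which is multiplied by a bump function; for `t` close to `1` the result still generates a
contactomorphism (`exists_cutoff_dilation`). No flows are needed. -/

open Set Filter Topology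

/-! ### Contact transformations of a normed space carrying a 1-form -/

section ContactTransformations

variable {X : Type*} [NormedAddCommGroup X] [NormedSpace ℝ X]

/-- The diffeomorphisms of `X` preserving the kernel of the 1-form `α`. -/
def contactGroup (α : X → X →L[ℝ] ℝ) : Subgroup (Equiv.Perm X) where
  carrier := {e | ContDiff ℝ ∞ e ∧ ContDiff ℝ ∞ e.symm ∧
    ∀ v w, α (e v) (fderiv ℝ e v w) = 0 ↔ α v w = 0}
  one_mem' := by
    refine ⟨contDiff_id, contDiff_id, fun v w => ?_⟩
    have h : (⇑(1 : Equiv.Perm X)) = id := rfl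
    rw [h, fderiv_id]
    rfl
  mul_mem' := by
    rintro a b ⟨ha, ha', hα⟩ ⟨hb, hb', hβ⟩
    refine ⟨ha.comp hb, hb'.comp ha', fun v w => ?_⟩
    have h : (⇑(a * b)) = a ∘ b := rfl
    rw [h, fderiv_comp v (ha.differentiable (by simp) _) (hb.differentiable (by simp) _)]
    exact (hα (b v) _).trans (hβ v w)
  inv_mem' := by
    rintro a ⟨ha, ha', hα⟩
    refine ⟨ha', ha, fun v w => ?_⟩
    have h : (⇑(a⁻¹)) = a.symm := rfl
    have key := hα (a.symm v) (fderiv ℝ a.symm v w)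
    have hid : a ∘ a.symm = id := by ext x; simp
    have h2 : fderiv ℝ a (a.symm v) (fderiv ℝ a.symm v w) = w := by
      have := fderiv_comp v (ha.differentiable (by simp) (a.symm v))
        (ha'.differentiable (by simp) v)
      rw [hid, fderiv_id] at this
      exact (congrArg (fun L => L w) this).symm
    rw [h2, Equiv.apply_symm_apply] at key
    rw [h]
    exact key.symm

/-- A small perturbation of the identity is a diffeomorphism. -/
theorem exists_diffeo_of_norm_fderiv_le [FiniteDimensional ℝ X] {u : X → X}
    (hu : ContDiff ℝ ∞ u) (hle : ∀ v, ‖fderiv ℝ u v‖ ≤ 1 / 2) :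
    ∃ e : Equiv.Perm X, (∀ v, e v = v + u v) ∧ ContDiff ℝ ∞ e ∧ ContDiff ℝ ∞ e.symm := by
  have := FiniteDimensional.complete ℝ X
  have hud : Differentiable ℝ u := hu.differentiable (by simp)
  have hlip : LipschitzWith (1 / 2) u := by
    refine lipschitzWith_of_nnnorm_fderiv_le (𝕜 := ℝ) hud fun v => ?_
    rw [← NNReal.coe_le_coe]
    simpa using hle v
  set f : X → X := fun v => v + u v with hf
  -- Since `f - id` is Lipschitz with constant `1 / 2 < 1`, `f` is a global homeomorphism.
  have happ : ApproximatesLinearOn f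
      ((ContinuousLinearEquiv.refl ℝ X : X ≃L[ℝ] X) : X →L[ℝ] X) univ (1 / 2) := by
    intro x _ y _
    have h1 : f x - f y - ((ContinuousLinearEquiv.refl ℝ X : X ≃L[ℝ] X) : X →L[ℝ] X) (x - y)
        = u x - u y := by
      simp [hf]; abel
    rw [h1]
    exact hlip.norm_sub_le x y
  have hc : Subsingleton X ∨ (1 / 2 : NNReal) <
      ‖((ContinuousLinearEquiv.refl ℝ X).symm : X →L[ℝ] X)‖₊⁻¹ := by
    rcases subsingleton_or_nontrivial X with h | h
    · exact Or.inl h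
    · right
      have : ‖((ContinuousLinearEquiv.refl ℝ X).symm : X →L[ℝ] X)‖₊ = 1 :=
        ContinuousLinearMap.nnnorm_id
      rw [this, inv_one, ← NNReal.coe_lt_coe]
      norm_num
  set e : X ≃ₜ X := happ.toHomeomorph f hc
  have hef : ⇑e = f := rfl
  have hfs : ContDiff ℝ ∞ f := contDiff_id.add hu
  -- Smoothness of the inverse needs invertible derivatives; in finite dimension injectivity is
  -- enough.
  have hinj : ∀ v, Function.Injective
      ((ContinuousLinearMap.id ℝ X + fderiv ℝ u v : X →L[ℝ] X) : X →ₗ[ℝ] X) := by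
    intro v
    rw [← LinearMap.ker_eq_bot, LinearMap.ker_eq_bot']
    intro w hw
    have h1 : w = - fderiv ℝ u v w := by
      have : w + fderiv ℝ u v w = 0 := hw
      exact eq_neg_of_add_eq_zero_left this
    have h2 : ‖w‖ ≤ 1 / 2 * ‖w‖ := by
      calc ‖w‖ = ‖fderiv ℝ u v w‖ := by rw [← norm_neg (fderiv ℝ u v w), ← h1]
        _ ≤ ‖fderiv ℝ u v‖ * ‖w‖ := ContinuousLinearMap.le_opNorm _ _
        _ ≤ 1 / 2 * ‖w‖ := by gcongr; exact hle v
    have h3 := norm_nonneg w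
    exact norm_eq_zero.1 (by linarith)
  refine ⟨e.toEquiv, fun v => rfl, hfs, ?_⟩
  refine e.contDiff_symm (f₀' := fun v =>
    (LinearEquiv.ofInjectiveEndo _ (hinj v)).toContinuousLinearEquiv) (fun v => ?_) hfs
  have : HasFDerivAt f (ContinuousLinearMap.id ℝ X + fderiv ℝ u v) v :=
    (hasFDerivAt_id v).add (hud v).hasFDerivAt
  rw [hef]
  convert this using 1
  ext w
  rfl

/-- A family of maps with support in a compact set that vanishes for the parameter `t₀`
is, for parameters near `t₀`, a family of small perturbations of the identity. -/
theorem eventually_exists_diffeo [FiniteDimensional ℝ X] {q : ℝ × X → X} {Ω : Set (ℝ × X)}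
    (hΩ : IsOpen Ω) (hq : ContDiffOn ℝ ∞ q Ω) {t₀ : ℝ} (ht₀ : ∀ v, (t₀, v) ∈ Ω)
    (hq₀ : ∀ v, q (t₀, v) = 0) {K : Set X} (hK : IsCompact K)
    (hqK : ∀ t, ∀ v ∉ K, q (t, v) = 0) :
    ∀ᶠ t in 𝓝 t₀, ∃ e : Equiv.Perm X, (∀ v, e v = v + q (t, v)) ∧
      ContDiff ℝ ∞ e ∧ ContDiff ℝ ∞ e.symm := by
  have hder : ∀ t v, (t, v) ∈ Ω → HasFDerivAt (fun v => q (t, v))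
      ((fderiv ℝ q (t, v)).comp (ContinuousLinearMap.inr ℝ ℝ X)) v := by
    intro t v h
    have h1 : DifferentiableAt ℝ q (t, v) :=
      (hq.contDiffAt (hΩ.mem_nhds h)).differentiableAt (by simp)
    exact h1.hasFDerivAt.comp v (hasFDerivAt_prodMk_right t v)
  have hev : ∀ v ∈ K, ∀ᶠ z : ℝ × X in 𝓝 (t₀, v), (z.1, z.2) ∈ Ω ∧
      ‖(fderiv ℝ q (z.1, z.2)).comp (ContinuousLinearMap.inr ℝ ℝ X)‖ ≤ 1 / 2 := by
    intro v _
    have hΩv := hΩ.mem_nhds (ht₀ v)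
    refine (eventually_of_mem hΩv fun z hz => hz).and ?_
    have hcont : ContinuousAt (fun z : ℝ × X =>
        ‖(fderiv ℝ q (z.1, z.2)).comp (ContinuousLinearMap.inr ℝ ℝ X)‖) (t₀, v) := by
      have h1 : ContinuousAt (fderiv ℝ q) (t₀, v) :=
        ((hq.contDiffAt hΩv).fderiv_right (m := ∞) (by simp)).continuousAt
      exact (h1.clm_comp continuousAt_const).norm
    -- The slice at `t₀` vanishes identically, hence so does its derivative; continuity gives the
    -- bound nearby.
    have hz : ‖(fderiv ℝ q (t₀, v)).comp (ContinuousLinearMap.inr ℝ ℝ X)‖ = 0 := by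
      rw [(hder t₀ v (ht₀ v)).unique (by simpa [hq₀] using hasFDerivAt_const (0 : X) v), norm_zero]
    exact hcont.eventually_le_const (u := 1 / 2) (hz.trans_lt (by norm_num))
  -- Compactness of `K` gives one neighbourhood of `t₀` that serves all `v ∈ K`.
  filter_upwards [hK.eventually_forall_of_forall_eventually (P := fun t v => (t, v) ∈ Ω ∧
      ‖(fderiv ℝ q (t, v)).comp (ContinuousLinearMap.inr ℝ ℝ X)‖ ≤ 1 / 2) hev] with t ht
  have hzero : ∀ v ∉ K, (fun v => q (t, v)) =ᶠ[𝓝 v] fun _ => 0 := fun v hv => by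
    filter_upwards [hK.isClosed.isOpen_compl.mem_nhds hv] with w hw using hqK t w hw
  refine exists_diffeo_of_norm_fderiv_le (contDiff_iff_contDiffAt.2 fun v => ?_) fun v => ?_
  · by_cases hv : v ∈ K
    · exact (hq.contDiffAt (hΩ.mem_nhds (ht v hv).1)).comp v
        (contDiff_prodMk_right t).contDiffAt
    · exact contDiffAt_const.congr_of_eventuallyEq (hzero v hv)
  · by_cases hv : v ∈ K
    · rw [(hder t v (ht v hv).1).fderiv]
      exact (ht v hv).2
    · rw [(hzero v hv).fderiv_eq]
      simp

end ContactTransformations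

/-! ### Contact transformations from generating functions -/

section GeneratingFunctions

variable (H : Type*) [NormedAddCommGroup H] [InnerProductSpace ℝ H]

/-- The standard contact form `dz + ⟨x, dy⟩` on `H × H × ℝ`, with coordinates `(x, y, z)`. -/
noncomputable def jetForm (v : H × H × ℝ) : (H × H × ℝ) →L[ℝ] ℝ :=
  (ContinuousLinearMap.snd ℝ H ℝ).comp (ContinuousLinearMap.snd ℝ H (H × ℝ)) +
    (innerSL ℝ v.1).comp ((ContinuousLinearMap.fst ℝ H ℝ).comp
      (ContinuousLinearMap.snd ℝ H (H × ℝ)))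

variable {H} in
@[simp]
theorem jetForm_apply (v w : H × H × ℝ) : jetForm H v w = w.2.2 + inner ℝ v.1 w.2.1 := rfl

/-- The `z`-part of a linear functional on `H × H × ℝ`. -/
noncomputable def partZ : ((H × H × ℝ) →L[ℝ] ℝ) →L[ℝ] ℝ :=
  ContinuousLinearMap.apply ℝ ℝ ((0, 0, 1) : H × H × ℝ)

variable {H} in
theorem partZ_apply (ℓ : (H × H × ℝ) →L[ℝ] ℝ) : partZ H ℓ = ℓ (0, 0, 1) := rfl

variable [FiniteDimensional ℝ H]

/-- The Riesz representation of linear functionals, as a continuous linear map. -/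
noncomputable def rieszMap : (H →L[ℝ] ℝ) →L[ℝ] H :=
  have := FiniteDimensional.complete ℝ H
  LinearMap.toContinuousLinearMap
    { toFun := fun ℓ => (InnerProductSpace.toDual ℝ H).symm ℓ
      map_add' := fun a b => by simp
      map_smul' := fun c a => by simp }

/-- The `x`-part of a linear functional on `H × H × ℝ`, as a vector. -/
noncomputable def gradX : ((H × H × ℝ) →L[ℝ] ℝ) →L[ℝ] H :=
  (rieszMap H).comp ((ContinuousLinearMap.compL ℝ H (H × H × ℝ) ℝ).flip
    (ContinuousLinearMap.inl ℝ H (H × ℝ)))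

/-- The `y`-part of a linear functional on `H × H × ℝ`, as a vector. -/
noncomputable def gradY : ((H × H × ℝ) →L[ℝ] ℝ) →L[ℝ] H :=
  (rieszMap H).comp ((ContinuousLinearMap.compL ℝ H (H × H × ℝ) ℝ).flip
    ((ContinuousLinearMap.inr ℝ H (H × ℝ)).comp (ContinuousLinearMap.inl ℝ H ℝ)))

variable {H}

theorem inner_rieszMap (ℓ : H →L[ℝ] ℝ) (h : H) : inner ℝ (rieszMap H ℓ) h = ℓ h := by
  have := FiniteDimensional.complete ℝ H
  exact InnerProductSpace.toDual_symm_apply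

theorem inner_gradX (ℓ : (H × H × ℝ) →L[ℝ] ℝ) (h : H) : inner ℝ (gradX H ℓ) h = ℓ (h, 0, 0) :=
  inner_rieszMap _ h

theorem inner_gradY (ℓ : (H × H × ℝ) →L[ℝ] ℝ) (h : H) : inner ℝ (gradY H ℓ) h = ℓ (0, h, 0) :=
  inner_rieszMap _ h

theorem gradX_eq {ℓ : (H × H × ℝ) →L[ℝ] ℝ} {a : H} (h : ∀ h, ℓ (h, 0, 0) = inner ℝ a h) :
    gradX H ℓ = a :=
  ext_inner_right ℝ fun v => by rw [inner_gradX, h]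

theorem gradY_eq {ℓ : (H × H × ℝ) →L[ℝ] ℝ} {a : H} (h : ∀ h, ℓ (0, h, 0) = inner ℝ a h) :
    gradY H ℓ = a :=
  ext_inner_right ℝ fun v => by rw [inner_gradY, h]

theorem apply_eq_inner_add (ℓ : (H × H × ℝ) →L[ℝ] ℝ) (h : H × H × ℝ) :
    ℓ h = inner ℝ (gradX H ℓ) h.1 + inner ℝ (gradY H ℓ) h.2.1 + partZ H ℓ * h.2.2 := by
  rw [inner_gradX, inner_gradY, partZ_apply, mul_comm, ← smul_eq_mul, ← map_smul, ← map_add,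
    ← map_add]
  congr 1
  ext <;> simp

/-- The displacement of the map `(X, y, z) ↦ (W_y / W_z, y, z)`, where `W = z + ⟨X, y⟩ + S` and
`ℓ = dS`. -/
noncomputable def sourceShift (ℓ : (H × H × ℝ) →L[ℝ] ℝ) (w : H × H × ℝ) : H × H × ℝ :=
  ((1 + partZ H ℓ)⁻¹ • (gradY H ℓ - partZ H ℓ • w.1), 0, 0)

/-- The displacement of the map `(X, y, z) ↦ (X, W_X, W - ⟨X, W_X⟩)`, where
`W = z + ⟨X, y⟩ + S`, `s = S` and `ℓ = dS`. -/
noncomputable def targetShift (s : ℝ) (ℓ : (H × H × ℝ) →L[ℝ] ℝ) (w : H × H × ℝ) : H × H × ℝ :=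
  (0, gradX H ℓ, s - inner ℝ w.1 (gradX H ℓ))

/-- As `A` fixes `y` and `z` and has first component `W_y / W_z`, one gets `W_z · A^*(dz + ⟨x, dy⟩)
= W_z dz + ⟨W_y, dy⟩`. Here `W_z = 1 + S_z` and `W_y = X + S_y`. -/
theorem jetForm_fderiv_source {S : H × H × ℝ → ℝ} {A : H × H × ℝ → H × H × ℝ}
    (hA : Differentiable ℝ A) (hAS : ∀ w, A w = w + sourceShift (fderiv ℝ S w) w)
    {w : H × H × ℝ} (hz : 1 + partZ H (fderiv ℝ S w) ≠ 0) (h : H × H × ℝ) :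
    (1 + partZ H (fderiv ℝ S w)) * jetForm H (A w) (fderiv ℝ A w h) =
      (1 + partZ H (fderiv ℝ S w)) * h.2.2 + inner ℝ (w.1 + gradY H (fderiv ℝ S w)) h.2.1 := by
  have h2 : (fderiv ℝ A w h).2 = h.2 := by
    have h3 := (hA w).hasFDerivAt.snd
    have h4 : (fun x => (A x).2) = Prod.snd := by
      ext x <;> simp [hAS x, sourceShift]
    rw [h4] at h3
    exact congrArg (fun L => L h) (h3.unique hasFDerivAt_snd)
  have h5 : (A w).1 = w.1 + (1 + partZ H (fderiv ℝ S w))⁻¹ •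
      (gradY H (fderiv ℝ S w) - partZ H (fderiv ℝ S w) • w.1) := by
    simp [hAS w, sourceShift]
  rw [jetForm_apply, h2, h5]
  simp only [inner_add_left, inner_smul_left, inner_sub_left, conj_trivial]
  field_simp
  ring

/-- The pullback is `d(W - ⟨X, W_X⟩) + ⟨X, dW_X⟩ = dW - ⟨W_X, dX⟩`, which is the same form `W_z dz +
⟨W_y, dy⟩`. -/
theorem jetForm_fderiv_target {S : H × H × ℝ → ℝ} {B : H × H × ℝ → H × H × ℝ}
    (hS : ContDiff ℝ ∞ S) (hBS : ∀ w, B w = w + targetShift (S w) (fderiv ℝ S w) w)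
    (w h : H × H × ℝ) :
    jetForm H (B w) (fderiv ℝ B w h) =
      (1 + partZ H (fderiv ℝ S w)) * h.2.2 + inner ℝ (w.1 + gradY H (fderiv ℝ S w)) h.2.1 := by
  set G : H × H × ℝ → H := fun w => gradX H (fderiv ℝ S w) with hG
  have hGd : DifferentiableAt ℝ G w :=
    (gradX H).differentiableAt.comp w
      ((hS.fderiv_right (m := ∞) (by simp)).differentiable (by simp) w)
  have hSd : DifferentiableAt ℝ S w := hS.differentiable (by simp) w
  have hB : B = fun w => (w.1, w.2.1 + G w, w.2.2 + (S w - inner ℝ w.1 (G w))) := by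
    funext w
    rw [hBS w]
    ext <;> simp [targetShift, hG]
  have h1 : HasFDerivAt (fun w : H × H × ℝ => w.1) (ContinuousLinearMap.fst ℝ H (H × ℝ)) w :=
    hasFDerivAt_fst
  have h2 : HasFDerivAt (fun w : H × H × ℝ => w.2) (ContinuousLinearMap.snd ℝ H (H × ℝ)) w :=
    hasFDerivAt_snd
  have hd := h1.prodMk ((h2.fst.add hGd.hasFDerivAt).prodMk
    (h2.snd.add (hSd.hasFDerivAt.sub (h1.inner ℝ hGd.hasFDerivAt))))
  rw [hB]
  have hd' : fderiv ℝ (fun w : H × H × ℝ =>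
    (w.1, w.2.1 + G w, w.2.2 + (S w - inner ℝ w.1 (G w)))) w = _ := hd.fderiv
  rw [hd']
  have hS' := apply_eq_inner_add (fderiv ℝ S w) h
  simp [inner_add_left, inner_add_right, real_inner_comm, hS', hG]
  ring

/-- The pullbacks of the contact form under `A` and `B` differ by the factor `W_z`, which has no
zeros, so `B ∘ A⁻¹` preserves its kernel. -/
theorem generated_mem_contactGroup {S : H × H × ℝ → ℝ} (hS : ContDiff ℝ ∞ S)
    (hz : ∀ w, 1 + partZ H (fderiv ℝ S w) ≠ 0) {A B : Equiv.Perm (H × H × ℝ)}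
    (hA : ContDiff ℝ ∞ A) (hA' : ContDiff ℝ ∞ A.symm)
    (hB : ContDiff ℝ ∞ B) (hB' : ContDiff ℝ ∞ B.symm)
    (hAS : ∀ w, A w = w + sourceShift (fderiv ℝ S w) w)
    (hBS : ∀ w, B w = w + targetShift (S w) (fderiv ℝ S w) w) :
    B * A⁻¹ ∈ contactGroup (jetForm H) := by
  refine ⟨hB.comp hA', hA.comp hB', fun v h => ?_⟩
  have hc : (⇑(B * A⁻¹)) = B ∘ A.symm := rfl
  have hAd : Differentiable ℝ A := hA.differentiable (by simp)
  have hid : A ∘ A.symm = id := by ext1 x; simp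
  have h2 : fderiv ℝ A (A.symm v) (fderiv ℝ A.symm v h) = h := by
    have := fderiv_comp v (hAd (A.symm v)) (hA'.differentiable (by simp) v)
    rw [hid, fderiv_id] at this
    exact (congrArg (fun L => L h) this).symm
  rw [hc, fderiv_comp v (hB.differentiable (by simp) _) (hA'.differentiable (by simp) _)]
  have key := (jetForm_fderiv_target hS hBS (A.symm v) (fderiv ℝ A.symm v h)).trans
    (jetForm_fderiv_source hAd hAS (hz (A.symm v)) (fderiv ℝ A.symm v h)).symm
  rw [h2, Equiv.apply_symm_apply] at key
  show jetForm H (B (A.symm v)) (fderiv ℝ B (A.symm v) (fderiv ℝ A.symm v h)) = 0 ↔ _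
  rw [key]
  simp only [mul_eq_zero, hz (A.symm v), false_or]

end GeneratingFunctions

/-! ### Dilations and their cut-offs -/

section Dilations

variable (H : Type*) [NormedAddCommGroup H] [InnerProductSpace ℝ H]

/-- The contact dilation `(x, y, z) ↦ (t x, t y, t² z)`. -/
@[simps]
noncomputable def dilation (t : ℝ) (ht : t ≠ 0) : Equiv.Perm (H × H × ℝ) where
  toFun v := (t • v.1, t • v.2.1, t ^ 2 * v.2.2)
  invFun v := (t⁻¹ • v.1, t⁻¹ • v.2.1, (t ^ 2)⁻¹ * v.2.2)
  left_inv v := by ext <;> simp [ht]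
  right_inv v := by ext <;> simp [ht]

theorem dilation_mem_contactGroup {t : ℝ} (ht : t ≠ 0) :
    dilation H t ht ∈ contactGroup (jetForm H) := by
  refine ⟨?_, ?_, fun v w => ?_⟩
  · show ContDiff ℝ ∞ fun v : H × H × ℝ => (t • v.1, t • v.2.1, t ^ 2 * v.2.2)
    fun_prop
  · show ContDiff ℝ ∞ fun v : H × H × ℝ => (t⁻¹ • v.1, t⁻¹ • v.2.1, (t ^ 2)⁻¹ * v.2.2)
    fun_prop
  · set L := (((t • ContinuousLinearMap.fst ℝ H (H × ℝ)).prod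
        ((t • (ContinuousLinearMap.fst ℝ H ℝ).comp (ContinuousLinearMap.snd ℝ H (H × ℝ))).prod
        (t ^ 2 • (ContinuousLinearMap.snd ℝ H ℝ).comp (ContinuousLinearMap.snd ℝ H (H × ℝ))))))
    have hd : HasFDerivAt (dilation H t ht) L v := L.hasFDerivAt
    rw [hd.fderiv]
    have : jetForm H (dilation H t ht v) (t • w.1, t • w.2.1, t ^ 2 * w.2.2) =
        t ^ 2 * jetForm H v w := by
      simp [inner_smul_left, inner_smul_right]
      ring
    show jetForm H (dilation H t ht v) (t • w.1, t • w.2.1, t ^ 2 * w.2.2) = 0 ↔ _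
    rw [this]
    simp [ht]

variable {H}

theorem norm_dilation_le {t : ℝ} (ht : t ≠ 0) (h0 : 0 ≤ t) (h1 : t ≤ 1) (v : H × H × ℝ) :
    ‖dilation H t ht v‖ ≤ t * ‖v‖ := by
  have ha := norm_fst_le v
  have hb := (norm_fst_le v.2).trans (norm_snd_le v)
  have hc := (norm_snd_le v.2).trans (norm_snd_le v)
  have hv := norm_nonneg v
  simp only [dilation_apply, Prod.norm_def, norm_smul, norm_mul, norm_pow,
    Real.norm_of_nonneg h0, sup_le_iff]
  change _ ≤ t * ‖v‖ ∧ _ ≤ t * ‖v‖ ∧ _ ≤ t * ‖v‖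
  refine ⟨by gcongr, by gcongr, ?_⟩
  calc t ^ 2 * ‖v.2.2‖ ≤ t * ‖v.2.2‖ := by
        gcongr
        nlinarith
    _ ≤ t * ‖v‖ := by gcongr

variable [FiniteDimensional ℝ H]

/-- The contact dilation by a suitable `t < 1` can be cut off outside a compact set. -/
theorem exists_cutoff_dilation (R : ℝ) (hR : 0 ≤ R) :
    ∃ (t : ℝ) (ht : t ≠ 0) (R' : ℝ), 0 < t ∧ t < 1 ∧ R ≤ R' ∧ ∃ g ∈ contactGroup (jetForm H),
      (∀ v, ‖v‖ ≤ R → g v = dilation H t ht v) ∧ ∀ v, R' < ‖v‖ → g v = v := by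
  -- The plateau radius exceeds `R`, so `χ = 1` near each point of norm at most `R` and derivatives
  -- there do not see the cut-off.
  let χ : ContDiffBump (0 : H × H × ℝ) := ⟨R + 1, R + 2, by linarith, by linarith⟩
  have hχ : ContDiff ℝ ∞ χ := χ.contDiff
  set f₁ : H × H × ℝ → ℝ := fun w => χ w * w.2.2 with hf₁
  set f₂ : H × H × ℝ → ℝ := fun w => χ w * inner ℝ w.1 w.2.1 with hf₂
  have h₁ : ContDiff ℝ ∞ f₁ := hχ.mul (by fun_prop)
  have h₂ : ContDiff ℝ ∞ f₂ := hχ.mul (contDiff_fst.inner ℝ (by fun_prop))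
  have hd₁ : Differentiable ℝ f₁ := h₁.differentiable (by simp)
  have hd₂ : Differentiable ℝ f₂ := h₂.differentiable (by simp)
  -- Where `χ = 1`, this gives `W = t² z + t ⟨X, y⟩`, the generating function of the dilation by
  -- `t`. It vanishes at `t = 1`.
  set S : ℝ → H × H × ℝ → ℝ := fun t w => (t ^ 2 - 1) * f₁ w + (t - 1) * f₂ w with hS
  set ℓ : ℝ × (H × H × ℝ) → (H × H × ℝ) →L[ℝ] ℝ :=
    fun q => (q.1 ^ 2 - 1) • fderiv ℝ f₁ q.2 + (q.1 - 1) • fderiv ℝ f₂ q.2 with hℓ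
  have hSc : ∀ t, ContDiff ℝ ∞ (S t) := fun t => by simp only [hS]; fun_prop
  have hfd : ∀ t w, fderiv ℝ (S t) w = ℓ (t, w) := fun t w =>
    (((hd₁ w).hasFDerivAt.const_mul (t ^ 2 - 1)).add
      ((hd₂ w).hasFDerivAt.const_mul (t - 1))).fderiv
  have hℓc : ContDiff ℝ ∞ ℓ := by
    have e₁ : ContDiff ℝ ∞ (fderiv ℝ f₁) := h₁.fderiv_right (by simp)
    have e₂ : ContDiff ℝ ∞ (fderiv ℝ f₂) := h₂.fderiv_right (by simp)
    have c₁ : ContDiff ℝ ∞ fun q : ℝ × (H × H × ℝ) => q.1 ^ 2 - 1 := by fun_prop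
    have c₂ : ContDiff ℝ ∞ fun q : ℝ × (H × H × ℝ) => q.1 - 1 := by fun_prop
    have : IsBoundedSMul ℝ ((H × H × ℝ) →L[ℝ] ℝ) :=
      NormedSpace.toIsBoundedSMul (𝕜 := ℝ) (E := (H × H × ℝ) →L[ℝ] ℝ)
    exact (c₁.smul (e₁.comp contDiff_snd)).add (c₂.smul (e₂.comp contDiff_snd))
  have hSj : ContDiff ℝ ∞ fun q : ℝ × (H × H × ℝ) => S q.1 q.2 := by
    simp only [hS]; fun_prop
  have hℓ1 : ∀ w, ℓ (1, w) = 0 := fun w => by simp [hℓ]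
  set K := Metric.closedBall (0 : H × H × ℝ) (R + 2) with hKdef
  have hK : IsCompact K := isCompact_closedBall _ _
  have hout : ∀ w ∉ K, f₁ w = 0 ∧ f₂ w = 0 := fun w hw => by
    have : χ w = 0 := χ.zero_of_le_dist (by
      rw [hKdef, Metric.mem_closedBall, not_le] at hw; exact hw.le)
    simp [hf₁, hf₂, this]
  have hSK : ∀ t, ∀ w ∉ K, S t w = 0 := fun t w hw => by simp [hS, hout w hw]
  have hℓK : ∀ t, ∀ w ∉ K, ℓ (t, w) = 0 := fun t w hw => by
    rw [← hfd]
    have : S t =ᶠ[𝓝 w] fun _ => 0 := by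
      filter_upwards [hK.isClosed.isOpen_compl.mem_nhds hw] with v hv using hSK t v hv
    rw [this.fderiv_eq, fderiv_fun_const]
    rfl
  set Ω : Set (ℝ × (H × H × ℝ)) := {q | 1 + partZ H (ℓ q) ≠ 0} with hΩ
  have hΩo : IsOpen Ω :=
    isOpen_ne_fun (continuous_const.add ((partZ H).continuous.comp hℓc.continuous))
      continuous_const
  have hΩ1 : ∀ w, (1, w) ∈ Ω := fun w => by simp [hΩ, hℓ1]
  have hsrc := eventually_exists_diffeo (q := fun q => sourceShift (ℓ q) q.2) hΩo (by
    have e₁ : ContDiff ℝ ∞ fun q => partZ H (ℓ q) := hℓc.continuousLinearMap_comp (partZ H)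
    have e₂ : ContDiff ℝ ∞ fun q => gradY H (ℓ q) := hℓc.continuousLinearMap_comp (gradY H)
    have e₃ : ContDiffOn ℝ ∞ (fun q => (1 + partZ H (ℓ q))⁻¹) Ω :=
      (contDiff_const.add e₁).contDiffOn.inv fun q hq => hq
    refine ContDiffOn.prodMk (e₃.smul ?_) contDiffOn_const
    exact (e₂.sub (e₁.smul (by fun_prop))).contDiffOn) (t₀ := 1) hΩ1
    (fun v => by simp [sourceShift, hℓ1]) hK
    (fun t v hv => by simp [sourceShift, hℓK t v hv])
  have htgt := eventually_exists_diffeo (q := fun q => targetShift (S q.1 q.2) (ℓ q) q.2)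
    (Ω := univ) isOpen_univ (by
    have e₂ : ContDiff ℝ ∞ fun q => gradX H (ℓ q) := hℓc.continuousLinearMap_comp (gradX H)
    refine (contDiff_const.prodMk (e₂.prodMk (hSj.sub (ContDiff.inner ℝ ?_ e₂)))).contDiffOn
    fun_prop) (t₀ := 1) (fun _ => mem_univ _)
    (fun v => by simp [targetShift, hℓ1, hS]) hK
    (fun t v hv => by simp [targetShift, hℓK t v hv, hSK t v hv])
  have hz : ∀ᶠ t in 𝓝 (1 : ℝ), ∀ w ∈ K, (t, w) ∈ Ω :=
    hK.eventually_forall_of_forall_eventually (P := fun t w => (t, w) ∈ Ω) fun w _ =>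
      hΩo.mem_nhds (hΩ1 w)
  have hpos : ∀ᶠ t in 𝓝 (1 : ℝ), 0 < t := eventually_gt_nhds one_pos
  obtain ⟨t, ⟨⟨A, hAe, hA, hA'⟩, ⟨B, hBe, hB, hB'⟩, hzt, ht0⟩, ht1⟩ :=
    ((((hsrc.and (htgt.and (hz.and hpos))).filter_mono nhdsWithin_le_nhds).and
      (self_mem_nhdsWithin : ∀ᶠ t in 𝓝[<] (1 : ℝ), t < 1))).exists
  have hzt' : ∀ w, 1 + partZ H (fderiv ℝ (S t) w) ≠ 0 := fun w => by
    rw [hfd]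
    by_cases hw : w ∈ K
    · exact hzt w hw
    · simp [hℓK t w hw]
  refine ⟨t, ht0.ne', R + 2, ht0, ht1, by linarith, B * A⁻¹,
    generated_mem_contactGroup (hSc t) hzt' hA hA' hB hB' (fun w => by rw [hfd, hAe])
      (fun w => by rw [hfd, hBe]), fun v hv => ?_, fun v hv => ?_⟩
  -- This is `A⁻¹ v`: for the dilation, `W_y / W_z = X / t`. Because `t < 1`, the point stays in the
  -- ball of radius `R`.
  · set w : H × H × ℝ := (t • v.1, v.2) with hw
    have hwR : ‖w‖ ≤ R := by
      refine le_trans ?_ hv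
      simp only [hw, Prod.norm_def, norm_smul, Real.norm_of_nonneg ht0.le]
      gcongr
      exact mul_le_of_le_one_left (norm_nonneg _) ht1.le
    have hχ1 : χ =ᶠ[𝓝 w] 1 := χ.eventuallyEq_one_of_mem_ball (by
      rw [mem_ball_zero_iff]
      show ‖w‖ < R + 1
      linarith)
    have hSw : S t =ᶠ[𝓝 w] fun w => (t ^ 2 - 1) * w.2.2 + (t - 1) * inner ℝ w.1 w.2.1 := by
      filter_upwards [hχ1] with u hu
      simp [hS, hf₁, hf₂, hu]
    have hder : ∀ h, ℓ (t, w) h =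
        (t ^ 2 - 1) * h.2.2 + (t - 1) * (inner ℝ w.1 h.2.1 + inner ℝ h.1 w.2.1) := by
      intro h
      have h1 : HasFDerivAt (fun w : H × H × ℝ => w.1) (ContinuousLinearMap.fst ℝ H (H × ℝ)) w :=
        hasFDerivAt_fst
      have h2 : HasFDerivAt (fun w : H × H × ℝ => w.2) (ContinuousLinearMap.snd ℝ H (H × ℝ)) w :=
        hasFDerivAt_snd
      have hd : fderiv ℝ (fun w : H × H × ℝ => (t ^ 2 - 1) * w.2.2 +
          (t - 1) * inner ℝ w.1 w.2.1) w = _ :=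
        ((h2.snd.const_mul (t ^ 2 - 1)).add ((h1.inner ℝ h2.fst).const_mul (t - 1))).fderiv
      rw [← hfd, hSw.fderiv_eq, hd]
      simp
    have hX : gradX H (ℓ (t, w)) = (t - 1) • w.2.1 := gradX_eq fun h => by
      rw [hder]; simp [inner_smul_left, real_inner_comm]
    have hY : gradY H (ℓ (t, w)) = (t - 1) • w.1 := gradY_eq fun h => by
      rw [hder]; simp [inner_smul_left]
    have hZ : partZ H (ℓ (t, w)) = t ^ 2 - 1 := by
      rw [partZ_apply, hder]; simp
    have hAw : A w = v := by
      rw [hAe]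
      simp only [sourceShift, hY, hZ]
      ext
      · simp only [hw, Prod.fst_add, smul_smul, ← sub_smul, ← add_smul]
        have : t + (1 + (t ^ 2 - 1))⁻¹ * ((t - 1) * t - (t ^ 2 - 1) * t) = 1 := by
          have : t ≠ 0 := ht0.ne'
          have e : 1 + (t ^ 2 - 1) = t ^ 2 := by ring
          rw [e]
          field_simp
          ring
        rw [this, one_smul]
      · simp [hw]
      · simp [hw]
    have hv' : A⁻¹ v = w := by
      rw [← hAw]; exact A.symm_apply_apply w
    rw [Equiv.Perm.mul_apply, hv', hBe]
    simp only [targetShift, hX, hSw.eq_of_nhds]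
    ext
    · simp [hw]
    · simp [hw, sub_smul]
    · simp [hw, inner_smul_right, inner_smul_left]
      ring
  · have hvK : v ∉ K := by simpa [hKdef] using hv
    have hAv : A v = v := by rw [hAe]; simp [sourceShift, hℓK t v hvK]
    have hv' : A⁻¹ v = v := by
      conv_lhs => rw [← hAv]
      exact A.symm_apply_apply v
    rw [Equiv.Perm.mul_apply, hv', hBe]
    simp [targetShift, hℓK t v hvK, hSK t v hvK]

end Dilations

/-! ### Pushing a punctured space off a compact set -/

section Expansions

/-- Every compact set `K` is avoided by an injection of the complement of `p` that locally
coincides with elements of the contact group and is the identity outside a compact set. -/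
def Expandable {X : Type*} [NormedAddCommGroup X] [NormedSpace ℝ X] (α : X → X →L[ℝ] ℝ) (p : X) :
    Prop :=
  ∀ K : Set X, IsCompact K → ∃ (C : Set X) (F : X → X), IsCompact C ∧ InjOn F {p}ᶜ ∧
    (∀ v, v ≠ p → F v ∉ K) ∧ (∀ v ∉ C, F v = v) ∧
    ∀ v, v ≠ p → ∃ G ∈ contactGroup α, F =ᶠ[𝓝 v] G

theorem Expandable.transport {X Y : Type*} [NormedAddCommGroup X] [NormedSpace ℝ X]
    [NormedAddCommGroup Y] [NormedSpace ℝ Y] {α : X → X →L[ℝ] ℝ} {β : Y → Y →L[ℝ] ℝ}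
    (e : X ≃ₜ Y) (he : ∀ G ∈ contactGroup β, (e.toEquiv.trans G).trans e.symm.toEquiv ∈
      contactGroup α) {p : X} (h : Expandable β (e p)) : Expandable α p := by
  intro K hK
  obtain ⟨C, F, hC, hinj, havoid, hid, hloc⟩ := h (e '' K) (hK.image e.continuous)
  have hne : ∀ v, v ≠ p → e v ≠ e p := fun v hv h => hv (e.injective h)
  refine ⟨e ⁻¹' C, fun v => e.symm (F (e v)), e.isCompact_preimage.2 hC, ?_, ?_, ?_, ?_⟩
  · intro v hv w hw h
    exact e.injective (hinj (hne v hv) (hne w hw) (e.symm.injective h))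
  · intro v hv hK
    exact havoid (e v) (hne v hv) ⟨_, hK, e.apply_symm_apply _⟩
  · intro v hv
    simp [hid (e v) hv]
  · intro v hv
    obtain ⟨G, hG, hFG⟩ := hloc (e v) (hne v hv)
    refine ⟨_, he G hG, ?_⟩
    filter_upwards [e.continuous.continuousAt.eventually hFG] with w hw
    simp only [hw]
    rfl

variable (H : Type*) [NormedAddCommGroup H] [InnerProductSpace ℝ H]

variable {H} in
theorem norm_dilation_pow_le {t : ℝ} (ht : t ≠ 0) (h0 : 0 ≤ t) (h1 : t ≤ 1) (k : ℕ)
    (v : H × H × ℝ) : ‖(dilation H t ht ^ k) v‖ ≤ t ^ k * ‖v‖ := by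
  induction k with
  | zero => simp
  | succ k ih =>
    rw [pow_succ', Equiv.Perm.mul_apply, pow_succ', mul_assoc]
    exact (norm_dilation_le ht h0 h1 _).trans (by gcongr)

/-- The supports of the factors `h k` shrink to the origin, so the products `G k` stabilise near
every other point. Their limit `F` inherits injectivity and membership in the contact group locally.
-/
theorem expandable_jetForm_zero [FiniteDimensional ℝ H] : Expandable (jetForm H) 0 := by
  intro K hK
  obtain ⟨R, hRpos, hKR⟩ := hK.isBounded.subset_closedBall_lt 0 0
  obtain ⟨t, ht, R', h0, h1, hRR', g, hg, hgin, hgout⟩ := exists_cutoff_dilation (H := H) R hRpos.le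
  have hR' : 0 < R' := hRpos.trans_le hRR'
  set δ := dilation H t ht with hδ
  let h : ℕ → Equiv.Perm (H × H × ℝ) := fun k => δ ^ k * g⁻¹ * (δ ^ k)⁻¹
  -- `G k = h 0 * ⋯ * h (k - 1)`; the new factor acts first, so it changes nothing outside its small
  -- support.
  let G : ℕ → Equiv.Perm (H × H × ℝ) := fun k => Nat.rec 1 (fun k Gk => Gk * h k) k
  have hGsucc : ∀ k v, G (k + 1) v = G k (h k v) := fun k v => rfl
  have hδmem : ∀ k, δ ^ k ∈ contactGroup (jetForm H) := fun k =>
    pow_mem (dilation_mem_contactGroup H ht) k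
  have hGmem : ∀ k, G k ∈ contactGroup (jetForm H) := by
    intro k
    induction k with
    | zero => exact one_mem _
    | succ k ih => exact mul_mem ih (mul_mem (mul_mem (hδmem k) (inv_mem hg)) (inv_mem (hδmem k)))
  have hsupp : ∀ k v, t ^ k * R' < ‖v‖ → h k v = v := by
    intro k v hv
    obtain ⟨u, rfl⟩ := (δ ^ k).surjective v
    have hu : R' < ‖u‖ := by
      have := hv.trans_le (norm_dilation_pow_le ht h0.le h1.le k u)
      exact lt_of_mul_lt_mul_left this (by positivity)
    have : g⁻¹ u = u := by
      rw [Equiv.Perm.inv_eq_iff_eq]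
      exact (hgout u hu).symm
    show (δ ^ k) (g⁻¹ ((δ ^ k).symm ((δ ^ k) u))) = (δ ^ k) u
    rw [Equiv.symm_apply_apply, this]
  have hanti : ∀ {i j : ℕ}, i ≤ j → t ^ j * R' ≤ t ^ i * R' := fun hij => by
    gcongr ?_ * _
    exact pow_le_pow_of_le_one h0.le h1.le hij
  have hstab : ∀ j v, t ^ j * R' < ‖v‖ → ∀ k, j ≤ k → G k v = G j v := by
    intro j v hv k hk
    induction k, hk using Nat.le_induction with
    | base => rfl
    | succ k hk ih => rw [hGsucc, hsupp k v ((hanti hk).trans_lt hv), ih]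
  -- With `g = δ` on the ball of radius `R`, `h k` carries the `δ ^ (k + 1)`-image of this ball onto
  -- its `δ ^ k`-image. Hence only points of the `δ ^ k`-image reach the ball under `G k`.
  have havoid : ∀ k v, ‖G k v‖ ≤ R → ∃ u, ‖u‖ ≤ R ∧ v = (δ ^ k) u := by
    intro k
    induction k with
    | zero => exact fun v hv => ⟨v, hv, rfl⟩
    | succ k ih =>
      intro v hv
      obtain ⟨u, hu, hvu⟩ := ih _ hv
      refine ⟨u, hu, ?_⟩
      have e1 : g⁻¹ ((δ ^ k)⁻¹ v) = u := (δ ^ k).injective hvu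
      rw [Equiv.Perm.inv_eq_iff_eq, Equiv.Perm.inv_eq_iff_eq, hgin u hu] at e1
      rw [e1, pow_succ]
      rfl
  -- The limit value of `G j v`; only for `v = 0` is there no such `j`, and the value is then
  -- arbitrary.
  have hex : ∀ v, ∃ y, ∀ j, t ^ j * R' < ‖v‖ → y = G j v := by
    classical
    intro v
    by_cases hv : ∃ j, t ^ j * R' < ‖v‖
    · exact ⟨G (Nat.find hv) v, fun j hj =>
        (hstab _ v (Nat.find_spec hv) j (Nat.find_min' hv hj)).symm⟩
    · exact ⟨v, fun j hj => (hv ⟨j, hj⟩).elim⟩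
  choose F hF using hex
  have hscale : ∀ v : H × H × ℝ, v ≠ 0 → ∃ j : ℕ, t ^ j * R' < ‖v‖ := by
    intro v hv
    obtain ⟨j, hj⟩ := exists_pow_lt_of_lt_one (div_pos (norm_pos_iff.2 hv) hR') h1
    exact ⟨j, (lt_div_iff₀ hR').1 hj⟩
  refine ⟨Metric.closedBall 0 R', F, isCompact_closedBall _ _, ?_, ?_, ?_, ?_⟩
  · intro v hv w hw hvw
    obtain ⟨i, hi⟩ := hscale v hv
    obtain ⟨j, hj⟩ := hscale w hw
    rw [hF v (max i j) ((hanti (le_max_left i j)).trans_lt hi),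
      hF w (max i j) ((hanti (le_max_right i j)).trans_lt hj)] at hvw
    exact (G _).injective hvw
  · intro v hv hK
    obtain ⟨j, hj⟩ := hscale v hv
    rw [hF v j hj] at hK
    obtain ⟨u, hu, rfl⟩ := havoid j v (by simpa using hKR hK)
    -- A point sent into the ball would have norm at most `t ^ j * R ≤ t ^ j * R'`, against the
    -- choice of `j`.
    refine absurd hj (not_lt.2 ?_)
    refine (norm_dilation_pow_le ht h0.le h1.le j u).trans ?_
    gcongr
    exact hu.trans hRR'
  · intro v hv
    exact hF v 0 (by simpa using hv)
  · intro v hv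
    obtain ⟨j, hj⟩ := hscale v hv
    refine ⟨G j, hGmem j, ?_⟩
    filter_upwards [(isOpen_lt continuous_const continuous_norm).mem_nhds hj] with w hw
    exact hF w j hw

/-! ### Moving the puncture to the origin and passing to standard coordinates -/

/-- The left translation by `-p` of the Heisenberg group `H × H × ℝ`. -/
@[simps]
def heisenbergTranslation (p : H × H × ℝ) : Equiv.Perm (H × H × ℝ) where
  toFun v := (v.1 - p.1, v.2.1 - p.2.1, v.2.2 - p.2.2 + inner ℝ p.1 (v.2.1 - p.2.1))
  invFun v := (v.1 + p.1, v.2.1 + p.2.1, v.2.2 + p.2.2 - inner ℝ p.1 v.2.1)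
  left_inv v := by ext <;> simp; ring
  right_inv v := by ext <;> simp; ring

/-- The form itself is preserved: the term `⟨p.1, dy⟩` from the last coordinate compensates the
shift of `x`. -/
theorem heisenbergTranslation_mem_contactGroup (p : H × H × ℝ) :
    heisenbergTranslation H p ∈ contactGroup (jetForm H) := by
  refine ⟨?_, ?_, fun v w => ?_⟩
  · show ContDiff ℝ ∞ fun v : H × H × ℝ =>
      (v.1 - p.1, v.2.1 - p.2.1, v.2.2 - p.2.2 + inner ℝ p.1 (v.2.1 - p.2.1))
    exact ContDiff.prodMk (by fun_prop) (ContDiff.prodMk (by fun_prop)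
      (ContDiff.add (by fun_prop) (contDiff_const.inner ℝ (by fun_prop))))
  · show ContDiff ℝ ∞ fun v : H × H × ℝ =>
      (v.1 + p.1, v.2.1 + p.2.1, v.2.2 + p.2.2 - inner ℝ p.1 v.2.1)
    exact ContDiff.prodMk (by fun_prop) (ContDiff.prodMk (by fun_prop)
      (ContDiff.sub (by fun_prop) (contDiff_const.inner ℝ (by fun_prop))))
  · have h1 : HasFDerivAt (fun w : H × H × ℝ => w.1) (ContinuousLinearMap.fst ℝ H (H × ℝ)) v :=
      hasFDerivAt_fst
    have h2 : HasFDerivAt (fun w : H × H × ℝ => w.2) (ContinuousLinearMap.snd ℝ H (H × ℝ)) v :=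
      hasFDerivAt_snd
    have hd : fderiv ℝ (heisenbergTranslation H p) v = _ :=
      ((h1.sub_const p.1).prodMk ((h2.fst.sub_const p.2.1).prodMk ((h2.snd.sub_const p.2.2).add
        ((innerSL ℝ p.1).hasFDerivAt.comp v (h2.fst.sub_const p.2.1))))).fderiv
    rw [hd]
    simp [inner_sub_left, add_assoc]

theorem conj_mem_contactGroup {X Y : Type*} [NormedAddCommGroup X] [NormedSpace ℝ X]
    [NormedAddCommGroup Y] [NormedSpace ℝ Y] {α : X → X →L[ℝ] ℝ} {β : Y → Y →L[ℝ] ℝ}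
    (L : X ≃L[ℝ] Y) (hL : ∀ u w, α u w = β (L u) (L w)) {G : Equiv.Perm Y}
    (hG : G ∈ contactGroup β) :
    (L.toEquiv.trans G).trans L.symm.toEquiv ∈ contactGroup α := by
  obtain ⟨h1, h2, h3⟩ := hG
  refine ⟨L.symm.contDiff.comp (h1.comp L.contDiff), L.symm.contDiff.comp (h2.comp L.contDiff),
    fun v w => ?_⟩
  have hd : HasFDerivAt ((L.toEquiv.trans G).trans L.symm.toEquiv)
      ((L.symm : Y →L[ℝ] X).comp ((fderiv ℝ G (L v)).comp (L : X →L[ℝ] Y))) v :=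
    L.symm.hasFDerivAt.comp v (((h1.differentiable (by simp) (L v)).hasFDerivAt).comp v
      L.hasFDerivAt)
  rw [hd.fderiv, hL, hL]
  have := h3 (L v) (L w)
  simpa using this

/-- The splitting `ℝ^{2n+1} = ℝ^n × ℝ^n × ℝ` into the coordinates `x`, `y` and `z`. -/
noncomputable def contactModelSplit (n : ℕ) : ContactModel n ≃L[ℝ]
    (EuclideanSpace ℝ (Fin n) × EuclideanSpace ℝ (Fin n) × ℝ) :=
  LinearEquiv.toContinuousLinearEquiv
    { toFun := fun u => (WithLp.toLp 2 fun i => u ⟨i.val, by omega⟩,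
        WithLp.toLp 2 fun i => u ⟨n + i.val, by omega⟩, u (Fin.last (2 * n)))
      map_add' := fun u v => by ext <;> simp
      map_smul' := fun c u => by ext <;> simp
      invFun := fun v => WithLp.toLp 2 fun k =>
        if h : k.val < n then v.1 ⟨k.val, h⟩
        else if h' : k.val < 2 * n then v.2.1 ⟨k.val - n, by omega⟩ else v.2.2
      left_inv := fun u => by
        ext k
        by_cases h : k.val < n
        · simp [h]
        · by_cases h' : k.val < 2 * n
          · simp [h, h', Nat.add_sub_cancel' (not_lt.1 h)]
          · have : k = Fin.last (2 * n) := by ext; simp; omega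
            simp [this]
      right_inv := fun v => by
        ext i
        · simp
        · have : n + i.val < 2 * n := by omega
          simp [this]
        · have : ¬ 2 * n < n := by omega
          simp [this] }

theorem stdContactForm_eq_jetForm (n : ℕ) (u w : ContactModel n) : stdContactForm n u w =
    jetForm (EuclideanSpace ℝ (Fin n)) (contactModelSplit n u) (contactModelSplit n w) := by
  simp [stdContactForm, contactModelSplit, PiLp.inner_apply, mul_comm]

theorem expandable_stdContactForm (n : ℕ) (p : ContactModel n) :
    Expandable (stdContactForm n) p := by
  set L := contactModelSplit n
  set τ := heisenbergTranslation (EuclideanSpace ℝ (Fin n)) (L p) with hτ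
  have hmem := heisenbergTranslation_mem_contactGroup (EuclideanSpace ℝ (Fin n)) (L p)
  let τh : (EuclideanSpace ℝ (Fin n) × EuclideanSpace ℝ (Fin n) × ℝ) ≃ₜ
      (EuclideanSpace ℝ (Fin n) × EuclideanSpace ℝ (Fin n) × ℝ) :=
    ⟨τ, hmem.1.continuous, hmem.2.1.continuous⟩
  refine Expandable.transport (β := jetForm (EuclideanSpace ℝ (Fin n)))
    (L.toHomeomorph.trans τh) (fun G hG => ?_) ?_
  · exact conj_mem_contactGroup L (stdContactForm_eq_jetForm n)
      (mul_mem (mul_mem (inv_mem hmem) hG) hmem)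
  · have : (L.toHomeomorph.trans τh) p = 0 := by
      show τ (L p) = 0
      simp [hτ]
    rw [this]
    exact expandable_jetForm_zero _

end Expansions

/-! ### Local contactomorphisms of manifolds -/

section LocalContactomorphisms

variable {n : ℕ} {M N Q : Type*}
  [TopologicalSpace M] [ChartedSpace (ContactModel n) M]
  [TopologicalSpace N] [ChartedSpace (ContactModel n) N]
  [TopologicalSpace Q] [ChartedSpace (ContactModel n) Q]

/-- The partial homeomorphism `e` is a diffeomorphism between open sets which pulls back `η`
to `ξ`. -/
def IsContactDiffeo (n : ℕ) {M N : Type*}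
    [TopologicalSpace M] [ChartedSpace (ContactModel n) M]
    [TopologicalSpace N] [ChartedSpace (ContactModel n) N]
    (ξ : PlaneField n M) (η : PlaneField n N) (e : OpenPartialHomeomorph M N) : Prop :=
  IsDiffeoOnSource n e ∧ ∀ x ∈ e.source, pullbackField n e η x = ξ x

theorem IsDiffeoOnSource.mdifferentiable {e : OpenPartialHomeomorph M N}
    (h : IsDiffeoOnSource n e) : e.MDifferentiable (𝓡 (2 * n + 1)) (𝓡 (2 * n + 1)) :=
  ⟨h.1.mdifferentiableOn (by simp), h.2.mdifferentiableOn (by simp)⟩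

/-- All tangent spaces are the model space by definition; this moves a vector between the fibres
over points that are only provably equal. -/
theorem PlaneField.mem_congr (ξ : PlaneField n M) {x y : M} (h : x = y) (v : ContactModel n) :
    (show TangentSpace (𝓡 (2 * n + 1)) x from v) ∈ ξ x ↔
      (show TangentSpace (𝓡 (2 * n + 1)) y from v) ∈ ξ y := by
  subst h
  rfl

theorem mem_iff_of_pullbackField_eq {f : M → N} {ξ : PlaneField n M} {η : PlaneField n N} {x : M}
    (h : pullbackField n f η x = ξ x) (v : TangentSpace (𝓡 (2 * n + 1)) x) :
    mfderiv (𝓡 (2 * n + 1)) (𝓡 (2 * n + 1)) f x v ∈ η (f x) ↔ v ∈ ξ x := by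
  rw [← h]
  rfl

variable {ξ : PlaneField n M} {η : PlaneField n N} {ζ : PlaneField n Q}

/-- Bridges the pullback condition of Darboux charts and the image condition of `Contactomorphic`;
they agree because the differential is bijective. -/
theorem isContactDiffeo_iff_map {e : OpenPartialHomeomorph M N} :
    IsContactDiffeo n ξ η e ↔ IsDiffeoOnSource n e ∧ ∀ x ∈ e.source,
      (ξ x).map (mfderiv (𝓡 (2 * n + 1)) (𝓡 (2 * n + 1)) e x).toLinearMap = η (e x) := by
  refine and_congr_right fun he => forall₂_congr fun x hx => ⟨fun h => ?_, fun h => ?_⟩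
  · rw [← h]
    exact Submodule.map_comap_eq_of_surjective (he.mdifferentiable.mfderiv_surjective hx) _
  · unfold pullbackField
    rw [← h]
    exact Submodule.comap_map_eq_of_injective (he.mdifferentiable.mfderiv_injective hx) _

theorem IsContactDiffeo.symm {e : OpenPartialHomeomorph M N} (h : IsContactDiffeo n ξ η e) :
    IsContactDiffeo n η ξ e.symm := by
  refine ⟨⟨h.1.2, h.1.1⟩, fun y hy => ?_⟩
  obtain ⟨x, hx, rfl⟩ : ∃ x ∈ e.source, e x = y := ⟨e.symm y, e.map_target hy, e.right_inv hy⟩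
  ext v
  have h1 := mem_iff_of_pullbackField_eq (h.2 x hx)
    (mfderiv (𝓡 (2 * n + 1)) (𝓡 (2 * n + 1)) e.symm (e x) v)
  have h2 : mfderiv (𝓡 (2 * n + 1)) (𝓡 (2 * n + 1)) e x
      (mfderiv (𝓡 (2 * n + 1)) (𝓡 (2 * n + 1)) e.symm (e x) v) = v := by
    have := h.1.mdifferentiable.comp_symm_deriv (e.map_source hx)
    rw [e.left_inv hx] at this
    exact congrArg (fun L => L v) this
  rw [h2] at h1
  exact (ξ.mem_congr (e.left_inv hx) _).trans h1.symm

theorem IsContactDiffeo.trans {e : OpenPartialHomeomorph M N} {e' : OpenPartialHomeomorph N Q}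
    (h : IsContactDiffeo n ξ η e) (h' : IsContactDiffeo n η ζ e') :
    IsContactDiffeo n ξ ζ (e.trans e') := by
  refine ⟨⟨?_, ?_⟩, fun x hx => ?_⟩
  · rw [OpenPartialHomeomorph.trans_source]
    exact h'.1.1.comp' h.1.1
  · rw [OpenPartialHomeomorph.trans_target]
    exact h.1.2.comp' h'.1.2
  · rw [OpenPartialHomeomorph.trans_source] at hx
    ext v
    have hc := mfderiv_comp x (h'.1.mdifferentiable.mdifferentiableAt hx.2)
      (h.1.mdifferentiable.mdifferentiableAt hx.1)
    rw [← mem_iff_of_pullbackField_eq (h.2 x hx.1), ← mem_iff_of_pullbackField_eq (h'.2 _ hx.2)]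
    show mfderiv (𝓡 (2 * n + 1)) (𝓡 (2 * n + 1)) (e' ∘ e) x v ∈ ζ (e' (e x)) ↔ _
    rw [hc]
    rfl

theorem isContactDiffeo_refl (ξ : PlaneField n M) :
    IsContactDiffeo n ξ ξ (OpenPartialHomeomorph.refl M) := by
  refine ⟨⟨contMDiff_id.contMDiffOn, contMDiff_id.contMDiffOn⟩, fun x _ => ?_⟩
  ext v
  show mfderiv (𝓡 (2 * n + 1)) (𝓡 (2 * n + 1)) id x v ∈ ξ x ↔ _
  rw [mfderiv_id]
  rfl

theorem IsContactDiffeo.restrOpen {e : OpenPartialHomeomorph M N} (h : IsContactDiffeo n ξ η e)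
    {s : Set M} (hs : IsOpen s) : IsContactDiffeo n ξ η (e.restrOpen s hs) :=
  ⟨⟨h.1.1.mono fun _ hx => hx.1, h.1.2.mono fun _ hx => hx.1⟩, fun x hx => h.2 x hx.1⟩

/-- An injective map that locally agrees with contact diffeomorphisms is a contactomorphism onto
its image. -/
theorem contactomorphic_image [Nonempty M] {f : M → N} {U : Set M} (hU : IsOpen U)
    (hf : InjOn f U) (hloc : ∀ x ∈ U, ∃ e : OpenPartialHomeomorph M N,
      IsContactDiffeo n ξ η e ∧ x ∈ e.source ∧ f =ᶠ[𝓝 x] e) :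
    IsOpen (f '' U) ∧ Contactomorphic n ξ U η (f '' U) := by
  have hloc' : ∀ x ∈ U, ∃ e : OpenPartialHomeomorph M N, IsContactDiffeo n ξ η e ∧
      x ∈ e.source ∧ e.source ⊆ U ∧ EqOn f e e.source := by
    intro x hx
    obtain ⟨e, he, hxe, hfe⟩ := hloc x hx
    obtain ⟨s, hs, hso, hxs⟩ := mem_nhds_iff.1 (hfe.and (hU.mem_nhds hx))
    refine ⟨e.restrOpen s hso, he.restrOpen hso, ?_, ?_, ?_⟩
    · rw [OpenPartialHomeomorph.restrOpen_source]
      exact ⟨hxe, hxs⟩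
    · rw [OpenPartialHomeomorph.restrOpen_source]
      exact fun y hy => (hs hy.2).2
    · rw [OpenPartialHomeomorph.restrOpen_source]
      exact fun y hy => (hs hy.2).1
  have hcont : ContinuousOn f U := fun x hx => by
    obtain ⟨e, _, hxe, hfe⟩ := hloc x hx
    exact ((e.continuousAt hxe).congr hfe.symm).continuousWithinAt
  have hopen : IsOpenMap (U.domRestrict f) := by
    refine IsOpenMap.of_nhds_le fun x => ?_
    obtain ⟨e, _, hxe, hfe⟩ := hloc x x.2
    have h1 : map (U.domRestrict f) (𝓝 x) = map f (𝓝 (x : M)) := by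
      rw [← map_nhds_subtype_coe_eq_nhds x.2 (hU.mem_nhds x.2), Filter.map_map]
      rfl
    rw [h1, Filter.map_congr hfe, e.map_nhds_eq hxe]
    exact (congrArg 𝓝 hfe.eq_of_nhds).le
  let φ : OpenPartialHomeomorph M N :=
    OpenPartialHomeomorph.ofContinuousOpenRestrict (hf.toPartialEquiv f U) hcont hopen hU
  have hφs : φ.source = U := rfl
  have hφt : φ.target = f '' U := rfl
  have hφf : ⇑φ = f := rfl
  have hφ : IsContactDiffeo n ξ η φ := by
    refine ⟨⟨fun x hx => ?_, fun y hy => ?_⟩, fun x hx => ?_⟩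
    · obtain ⟨e, he, hxe, hfe⟩ := hloc x hx
      exact ((he.1.1.contMDiffAt (e.open_source.mem_nhds hxe)).congr_of_eventuallyEq
        hfe).contMDiffWithinAt
    · obtain ⟨x, hx, rfl⟩ := hy
      obtain ⟨e, he, hxe, heU, hfe⟩ := hloc' x hx
      have hmem : e.target ∈ 𝓝 (f x) := by
        rw [hfe hxe]
        exact e.open_target.mem_nhds (e.map_source hxe)
      -- Injectivity of `f` on `U ⊇ e.source` forces the global inverse to agree with the local one.
      have heq : φ.symm =ᶠ[𝓝 (f x)] e.symm := by
        filter_upwards [hmem] with z hz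
        have hz' := e.map_target hz
        have h1 : φ (e.symm z) = z := (hfe hz').trans (e.right_inv hz)
        rw [← h1, φ.left_inv (heU hz'), h1]
      exact ((he.1.2.contMDiffAt hmem).congr_of_eventuallyEq heq).contMDiffWithinAt
    · obtain ⟨e, he, hxe, hfe⟩ := hloc x hx
      ext v
      rw [← mem_iff_of_pullbackField_eq (he.2 x hxe) v]
      have hd : mfderiv (𝓡 (2 * n + 1)) (𝓡 (2 * n + 1)) f x =
        mfderiv (𝓡 (2 * n + 1)) (𝓡 (2 * n + 1)) e x := hfe.mfderiv_eq
      show mfderiv (𝓡 (2 * n + 1)) (𝓡 (2 * n + 1)) f x v ∈ η (f x) ↔ _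
      rw [hd]
      exact η.mem_congr hfe.eq_of_nhds _
  exact ⟨hφt ▸ φ.open_target, φ, hφ.1, hφs, hφt, (isContactDiffeo_iff_map.1 hφ).2⟩

theorem isContactDiffeo_of_mem_contactGroup {G : Equiv.Perm (ContactModel n)}
    (hG : G ∈ contactGroup (stdContactForm n)) :
    IsContactDiffeo n (stdContact n) (stdContact n)
      (Homeomorph.mk G hG.1.continuous hG.2.1.continuous).toOpenPartialHomeomorph := by
  refine ⟨⟨hG.1.contMDiff.contMDiffOn, hG.2.1.contMDiff.contMDiffOn⟩, fun x _ => ?_⟩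
  ext v
  show mfderiv (𝓡 (2 * n + 1)) (𝓡 (2 * n + 1)) G x v ∈ stdContact n (G x) ↔ _
  rw [mfderiv_eq_fderiv]
  exact hG.2.2 x v

/-- If the contact ball `σ(ℝ^{2n+1})` and the open set `B` cover `M`, then the complement of a point
of the ball embeds into `B`. -/
theorem exists_embedding_compl_singleton [T2Space M] [CompactSpace M]
    {σ : OpenPartialHomeomorph (ContactModel n) M} (hσ : IsContactDiffeo n (stdContact n) ξ σ)
    (hsource : σ.source = univ) {B : Set M} (hB : IsOpen B) (hcover : σ.target ∪ B = univ)
    {p : M} (hp : p ∈ σ.target) :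
    ∃ Φ : M → M, InjOn Φ {p}ᶜ ∧ MapsTo Φ {p}ᶜ B ∧ ∀ x ∈ ({p}ᶜ : Set M),
      ∃ e : OpenPartialHomeomorph M M, IsContactDiffeo n ξ ξ e ∧ x ∈ e.source ∧ Φ =ᶠ[𝓝 x] e := by
  classical
  have hBc : Bᶜ ⊆ σ.target := fun x hx =>
    (hcover.symm ▸ mem_univ x : x ∈ σ.target ∪ B).resolve_right hx
  -- The compact set to be avoided is the complement of `B`, seen in the ball.
  obtain ⟨C, F, hC, hinj, havoid, hid, hloc⟩ := expandable_stdContactForm n (σ.symm p)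
    (σ.symm '' Bᶜ) (hB.isClosed_compl.isCompact.image_of_continuousOn
      (σ.continuousOn_symm.mono hBc))
  have hσs : ∀ u, u ∈ σ.source := fun u => hsource ▸ mem_univ u
  have hne : ∀ x ∈ σ.target, x ≠ p → σ.symm x ≠ σ.symm p := fun x hx hxp h =>
    hxp (σ.symm.injOn hx hp h)
  set Φ : M → M := fun x => if x ∈ σ.target then σ (F (σ.symm x)) else x with hΦ
  have hin : ∀ x ∈ σ.target, Φ x = σ (F (σ.symm x)) := fun x hx => if_pos hx
  have hnin : ∀ x ∉ σ.target, Φ x = x := fun x hx => if_neg hx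
  have hmem : ∀ x, Φ x ∈ σ.target ↔ x ∈ σ.target := by
    intro x
    by_cases hx : x ∈ σ.target
    · simp only [hin x hx, hx, iff_true]
      exact σ.map_source (hσs _)
    · rw [hnin x hx]
  refine ⟨Φ, ?_, ?_, ?_⟩
  · intro x hx y hy hxy
    by_cases hxt : x ∈ σ.target
    · have hyt : y ∈ σ.target := by rwa [← hmem, ← hxy, hmem]
      rw [hin x hxt, hin y hyt] at hxy
      exact σ.symm.injOn hxt hyt
        (hinj (hne x hxt hx) (hne y hyt hy) (σ.injOn (hσs _) (hσs _) hxy))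
    · have hyt : y ∉ σ.target := by rwa [← hmem, ← hxy, hmem]
      rwa [hnin x hxt, hnin y hyt] at hxy
  · intro x hx
    by_cases hxt : x ∈ σ.target
    · by_contra hB'
      refine havoid _ (hne x hxt hx) ⟨Φ x, hB', ?_⟩
      rw [hin x hxt, σ.left_inv (hσs _)]
    · rw [hnin x hxt]
      exact not_not.1 fun h => hxt (hBc h)
  · intro x hx
    by_cases hxt : x ∈ σ.target
    · obtain ⟨G, hG, hFG⟩ := hloc _ (hne x hxt hx)
      refine ⟨_, (hσ.symm.trans (isContactDiffeo_of_mem_contactGroup hG)).trans hσ, ?_, ?_⟩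
      · simp [hxt, hsource]
      · filter_upwards [σ.open_target.mem_nhds hxt,
          (σ.continuousAt_symm hxt).eventually hFG] with y hy hy'
        rw [hin y hy, hy']
        rfl
    -- Gluing at the frontier of the ball: `σ '' C` is compact, hence closed in the Hausdorff space
    -- `M`, and `Φ` is the identity off it.
    · have hCc : IsClosed (σ '' C) :=
        (hC.image_of_continuousOn (σ.continuousOn.mono fun u _ => hσs u)).isClosed
      have hxC : x ∉ σ '' C := by
        rintro ⟨u, _, rfl⟩
        exact hxt (σ.map_source (hσs u))
      refine ⟨_, isContactDiffeo_refl ξ, mem_univ x, ?_⟩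
      filter_upwards [hCc.isOpen_compl.mem_nhds hxC] with y hy
      by_cases hyt : y ∈ σ.target
      · rw [hin y hyt, hid _ fun h => hy ⟨_, h, σ.right_inv hyt⟩]
        exact σ.right_inv hyt
      · exact hnin y hyt

theorem exists_contactBalls_union_eq_univ (hC : contactCoveringNumber n M ξ = 2) (p : M) :
    ∃ B B' : Set M, IsContactBall n ξ B ∧ IsContactBall n ξ B' ∧ p ∈ B ∧ B ∪ B' = univ := by
  obtain ⟨k, hk, B, hB, hcover⟩ : ∃ k : ℕ, k ≤ 2 ∧ ∃ B : Fin k → Set M,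
      (∀ i, IsContactBall n ξ (B i)) ∧ ⋃ i, B i = univ := by
    by_contra! hno
    have h3 : (3 : ℕ∞) ≤ contactCoveringNumber n M ξ := by
      refine le_iInf₂ fun k hk => ?_
      obtain ⟨B, hB, hcover⟩ := hk
      have : 3 ≤ k := by
        by_contra hk3
        exact hno k (by omega) B hB hcover
      exact_mod_cast this
    rw [hC] at h3
    exact absurd h3 (by decide)
  obtain ⟨i, hi⟩ := mem_iUnion.1 (hcover.symm ▸ mem_univ p : p ∈ ⋃ i, B i)
  by_cases h : ∃ j, j ≠ i
  · obtain ⟨j, hj⟩ := h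
    refine ⟨B i, B j, hB i, hB j, hi, eq_univ_of_univ_subset ?_⟩
    rw [← hcover]
    refine iUnion_subset fun l => ?_
    have : l = i ∨ l = j := by
      simp only [Fin.ext_iff, ne_eq] at hj ⊢
      omega
    rcases this with rfl | rfl
    · exact subset_union_left
    · exact subset_union_right
  -- A cover by a single ball is also admitted, that ball being used twice.
  · push Not at h
    refine ⟨B i, B i, hB i, hB i, hi, eq_univ_of_univ_subset ?_⟩
    rw [← hcover]
    exact iUnion_subset fun l => h l ▸ subset_union_left

end LocalContactomorphisms

/-! ### The proposition -/

theorem propositionp (n : ℕ) (ξ : PlaneField n (OddSphere n)) (hξ : IsContactStructure n ξ)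
    (hC : contactCoveringNumber n (OddSphere n) ξ = 2) (p : OddSphere n) :
    ∃ V : Set (ContactModel n), IsOpen V ∧
      Contactomorphic n ξ ({p}ᶜ : Set (OddSphere n)) (stdContact n) V := by
  obtain ⟨_, _, ⟨φ, ⟨hφ, ψ, hψd, hψs, hψt, hψξ⟩, rfl⟩, ⟨φ', ⟨hφ', -⟩, rfl⟩, hp, hcover⟩ :=
    exists_contactBalls_union_eq_univ hC p
  have hψ : IsContactDiffeo n (stdContact n) (stdContact n) ψ :=
    isContactDiffeo_iff_map.2 ⟨hψd, fun x hx => hψξ x (hψs ▸ hx)⟩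
  -- Reparametrises the ball around `p` by the whole of `ℝ^{2n+1}`, where the dilations live.
  have hσ : IsContactDiffeo n (stdContact n) ξ (ψ.symm.trans φ) := hψ.symm.trans hφ
  have hsource : (ψ.symm.trans φ).source = univ := by
    refine eq_univ_of_forall fun u => ?_
    have hu : u ∈ ψ.target := hψt ▸ mem_univ u
    rw [OpenPartialHomeomorph.trans_source]
    exact ⟨hu, show ψ.symm u ∈ φ.source from hψs ▸ ψ.map_target hu⟩
  have htarget : (ψ.symm.trans φ).target = φ.target := by
    rw [OpenPartialHomeomorph.trans_target]
    refine inter_eq_left.2 fun x hx => ?_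
    show φ.symm x ∈ ψ.source
    exact hψs ▸ φ.map_target hx
  obtain ⟨Φ, hinj, hmaps, hloc⟩ := exists_embedding_compl_singleton hσ hsource φ'.open_target
    (htarget ▸ hcover) (htarget ▸ hp)
  have : Nonempty (OddSphere n) := ⟨p⟩
  have := contactomorphic_image (ξ := ξ) (η := stdContact n) (f := φ'.symm ∘ Φ)
    isOpen_compl_singleton (φ'.symm.injOn.comp hinj hmaps) fun x hx => by
      obtain ⟨e, he, hxe, hΦe⟩ := hloc x hx
      have hx' := hmaps hx
      rw [hΦe.eq_of_nhds] at hx'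
      refine ⟨e.trans φ'.symm, he.trans (IsContactDiffeo.symm hφ'), ?_, ?_⟩
      · rw [OpenPartialHomeomorph.trans_source]
        exact ⟨hxe, hx'⟩
      · filter_upwards [hΦe] with y hy
        simp [hy]
  exact ⟨_, this⟩
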